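/- Let $C([0,1])$ denote the space of continuous maps $g:[0,1]\to[0,1]$ with the supremum distance, let $\mu$ be a Borel probability measure on $C([0,1])$, and let $\Gamma=\operatorname{supp}\mu$ be its topological support. A Borel probability measure $\nu$ on $[0,1]$ is called $\mu$-invariant if $$\nu(A)=\int_\Gamma \nu(g^{-1}(A))\,d\mu(g)\qquad\text{for every Borel set }A\subset[0,1],$$ and $(\Gamma,\mu)$ is called uniquely ergodic if there is exactly one $\mu$-invariant Borel probability measure on $[0,1]$. Write $\bigvee_0^1 g$ for the total variation of $g$ on $[0,1]$. Assume (BV) $\displaystyle \mu^{\otimes\mathbb N}\Big(\Big\{(g_1,g_2,\ldots)\in\Gamma^{\mathbb N}:\ \sup_{n\ge1}\bigvee_0^1 (g_1\circ g_2\circ\cdots\circ g_n)<\infty\Big\}\Big)>0,$ and assume that at least one of the following two conditions holds: (U1) for every $x\in(0,1)$ there exists $g\in\Gamma$ such that $g(x)<x$; (U2) for every $x\in(0,1)$ there exists $g\in\Gamma$ such that $g(x)>x$. Then there is at most one $\mu$-invariant Borel probability measure $\nu$ that is concentrated on $(0,1)$, i.e. satisfies $\nu((0,1))=1$. If, in addition,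 $\nu(\{0\})=\nu(\{1\})=0$ for every $\mu$-invariant Borel probability measure $\nu$ on $[0,1]$, then $(\Gamma,\mu)$ is uniquely ergodic. -/

import Mathlib

open MeasureTheory
open scoped unitInterval ENNReal

namespace StochSys

/-- The Borel σ-algebra of the space `C([0, 1], [0, 1])` of continuous self-maps of the unit
interval, whose topology in Mathlib is the one induced by the supremum distance. -/
instance instMeasurableSpaceCII : MeasurableSpace C(I, I) := borel C(I, I)

instance instBorelSpaceCII : BorelSpace C(I, I) := ⟨rfl⟩

/-- For a sequence `ω = (g₁, g₂, …)` with `gₖ = ω (k - 1)`, the composition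
`g₁ ∘ g₂ ∘ ⋯ ∘ gₙ` (the newest map is applied first); for `n = 0` it is the identity. -/
def compSeq (ω : ℕ → C(I, I)) : ℕ → C(I, I)
  | 0 => ContinuousMap.id I
  | n + 1 => (compSeq ω n).comp (ω n)

/-- The total variation of `g` on `[0, 1]`. -/
noncomputable def variation (g : C(I, I)) : ℝ≥0∞ := eVariationOn g Set.univ

/-- Condition (BV): with positive `μ^{⊗ℕ}`-probability, a sequence `(g₁, g₂, …)` of elements of
`Γ = supp μ` satisfies `sup_{n ≥ 1} ⋁₀¹ (g₁ ∘ ⋯ ∘ gₙ) < ∞`. -/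
def BV (μ : Measure C(I, I)) : Prop :=
  0 < Measure.infinitePi (fun _ : ℕ => μ)
    {ω : ℕ → C(I, I) | (∀ k, ω k ∈ μ.support) ∧
      (⨆ n : ℕ, ⨆ _ : 1 ≤ n, variation (compSeq ω n)) < ∞}

/-- Condition (U₁): every interior point is moved strictly to the left by some element of
`Γ = supp μ`. -/
def U1 (μ : Measure C(I, I)) : Prop :=
  ∀ x ∈ Set.Ioo (0 : I) 1, ∃ g ∈ μ.support, g x < x

/-- Condition (U₂): every interior point is moved strictly to the right by some element of
`Γ = supp μ`. -/
def U2 (μ : Measure C(I, I)) : Prop :=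
  ∀ x ∈ Set.Ioo (0 : I) 1, ∃ g ∈ μ.support, x < g x

/-- `ν` is a `μ`-invariant (`μ`-stationary) Borel probability measure on `[0, 1]`:
`ν(A) = ∫ ν(g⁻¹(A)) dμ(g)` for every Borel set `A`. -/
structure IsInvariantProb (μ : Measure C(I, I)) (ν : Measure I) : Prop where
  isProbabilityMeasure : IsProbabilityMeasure ν
  stationary : ∀ A : Set I, MeasurableSet A → ν A = ∫⁻ g, ν (g ⁻¹' A) ∂μ

/-- Unique ergodicity: there is exactly one `μ`-invariant Borel probability measure on `[0, 1]`. -/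
def UniquelyErgodic (μ : Measure C(I, I)) : Prop :=
  ∃! ν : Measure I, IsInvariantProb μ ν

end StochSys

/-!
Two different stationary measures on the interior would make the compositions `g₁ ∘ ⋯ ∘ gₙ`
oscillate between two separated sets arbitrarily often, which bounded variation forbids.

If `ν₁ ≠ ν₂` are stationary, the density of `ν₁` with respect to `ν = ν₁ + ν₂` is invariant along
the random iteration `x ↦ g x`. For stationary measures both `f (x)` and `f (g x)` define
isometries `L²(ν) → L²(μ ⊗ ν)`, and stationarity of `ν₁` says that they attain equality in
Cauchy–Schwarz at the density. A superlevel set `A` of the density then splits `ν` into two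
mutually singular stationary pieces (`exists_invariant_set`). Choose disjoint compact sets `K₁ ⊆
A` and `K₂ ⊆ Aᶜ` carrying most of the mass of these pieces. By von Neumann's mean ergodic theorem
for the Markov operator, after restricting to smaller stationary pieces the iterates started from
any part of the `i`-th piece spend, on time average, most of their time in `Kᵢ`
(`exists_restrict_cesaro_lt`). No ergodic decomposition is needed.

Under (U1) or (U2), the support of every stationary measure on the interior accumulates at the
same end of the interval (`Stationary.measure_lt_ne_zero`). Hence there are `m + 1` successive
intervals approaching that end which are charged alternately by the two pieces. Choosing one point
in each and one good time `n`, the map `g₁ ∘ ⋯ ∘ gₙ` sends, except on an event less likely than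
(BV), at least half of the pairs of consecutive points to different `Kᵢ`, so its variation is at
least a constant times `m` times the distance of `K₁` and `K₂`. For large `m` this contradicts
(BV) (`not_alternating`). Since (BV) has a fixed positive probability, it suffices that the
probability of failure is small compared with it, uniformly in `m`; that uniformity is what the
restriction to the smaller pieces provides.

Existence of a stationary measure is the Krylov–Bogolyubov argument (`exists_stationary`).
-/

namespace StochSys

open Filter Topology ProbabilityTheory

/-! ### Stationary measures and the evaluation map -/

/-- The evaluation map `(g, x) ↦ g x`, which performs one step of the random iteration. -/
def evalMap (p : C(I, I) × I) : I := p.1 p.2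

lemma continuous_evalMap : Continuous evalMap :=
  ContinuousEval.continuous_eval

lemma measurable_evalMap : Measurable evalMap :=
  continuous_evalMap.measurable

/-- Stationarity of a measure `ν` of arbitrary mass: if `g` and `x` are drawn independently
from `μ` and `ν`, then `g x` has distribution `ν`. -/
abbrev Stationary (μ : Measure C(I, I)) (ν : Measure I) : Prop :=
  MeasurePreserving evalMap (μ.prod ν) ν

lemma isInvariantProb_iff {μ : Measure C(I, I)} [IsProbabilityMeasure μ] {ν : Measure I}
    [IsProbabilityMeasure ν] : IsInvariantProb μ ν ↔ Stationary μ ν := by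
  have key : ∀ A : Set I, MeasurableSet A →
      (μ.prod ν).map evalMap A = ∫⁻ g, ν (g ⁻¹' A) ∂μ := fun A hA ↦ by
    rw [Measure.map_apply measurable_evalMap hA,
      Measure.prod_apply (measurable_evalMap hA)]
    rfl
  constructor
  · intro h
    refine ⟨measurable_evalMap, ?_⟩
    ext A hA
    rw [key A hA, ← h.stationary A hA]
  · intro h
    refine ⟨inferInstance, fun A hA ↦ ?_⟩
    rw [← key A hA, h.map_eq]

/-- Conditioning a stationary measure on an almost surely invariant set preserves stationarity. -/
lemma Stationary.restrict {μ : Measure C(I, I)} [IsProbabilityMeasure μ] {ν : Measure I}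
    [IsFiniteMeasure ν] (hν : Stationary μ ν) {E : Set I} (hE : MeasurableSet E)
    (h : ∀ᵐ p ∂μ.prod ν, p.1 p.2 ∈ E ↔ p.2 ∈ E) : Stationary μ (ν.restrict E) := by
  have h1 := hν.restrict_preimage hE
  have h2 : (μ.prod ν).restrict (evalMap ⁻¹' E) = μ.prod (ν.restrict E) := by
    have h3 : (evalMap ⁻¹' E : Set (C(I, I) × I)) =ᵐ[μ.prod ν] Set.univ ×ˢ E := by
      filter_upwards [h] with p hp
      have : (p ∈ evalMap ⁻¹' E) = (p ∈ Set.univ ×ˢ E) := by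
        simpa [evalMap] using hp
      exact this
    rw [Measure.restrict_congr_set h3, ← Measure.prod_restrict, Measure.restrict_univ]
  rwa [h2] at h1

/-! ### The Markov operator on `L²` -/

section Markov

variable {μ : Measure C(I, I)} [IsProbabilityMeasure μ] {ν : Measure I} [IsFiniteMeasure ν]

/-- The isometry `f ↦ ((g, x) ↦ f (g x))` from `L²(ν)` to `L²(μ ⊗ ν)`. -/
noncomputable def evalIsometry (hν : Stationary μ ν) : Lp ℝ 2 ν →ₗᵢ[ℝ] Lp ℝ 2 (μ.prod ν) :=
  Lp.compMeasurePreservingₗᵢ ℝ evalMap hν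

variable (μ ν) in
/-- The isometry `f ↦ ((g, x) ↦ f x)` from `L²(ν)` to `L²(μ ⊗ ν)`. -/
noncomputable def sndIsometry : Lp ℝ 2 ν →ₗᵢ[ℝ] Lp ℝ 2 (μ.prod ν) :=
  Lp.compMeasurePreservingₗᵢ ℝ Prod.snd measurePreserving_snd

lemma coeFn_evalIsometry {μ : Measure C(I, I)} {ν : Measure I} (hν : Stationary μ ν)
    (f : Lp ℝ 2 ν) :
    evalIsometry hν f =ᵐ[μ.prod ν] fun p ↦ f (p.1 p.2) :=
  Lp.coeFn_compMeasurePreserving f hν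

lemma coeFn_sndIsometry (f : Lp ℝ 2 ν) :
    sndIsometry μ ν f =ᵐ[μ.prod ν] fun p ↦ f p.2 :=
  Lp.coeFn_compMeasurePreserving f measurePreserving_snd

/-- The Markov operator `(P f) x = ∫ f (g x) dμ(g)` on `L²(ν)`. Integrating out `g` is the adjoint
of `sndIsometry`, so `P` is written as a product of an isometry and the adjoint of another one;
`markovOp_toLp` is the pointwise formula. -/
noncomputable def markovOp (hν : Stationary μ ν) : Lp ℝ 2 ν →L[ℝ] Lp ℝ 2 ν :=
  (sndIsometry μ ν).toContinuousLinearMap.adjoint ∘L (evalIsometry hν).toContinuousLinearMap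

lemma inner_markovOp (hν : Stationary μ ν) (u f : Lp ℝ 2 ν) :
    inner ℝ u (markovOp hν f) = inner ℝ (sndIsometry μ ν u) (evalIsometry hν f) := by
  simp [markovOp, ContinuousLinearMap.adjoint_inner_right]

lemma norm_markovOp_le (hν : Stationary μ ν) : ‖markovOp hν‖ ≤ 1 := by
  refine (ContinuousLinearMap.opNorm_comp_le _ _).trans ?_
  rw [LinearIsometryEquiv.norm_map]
  exact mul_le_one₀ (LinearIsometry.norm_toContinuousLinearMap_le _) (norm_nonneg _)
    (LinearIsometry.norm_toContinuousLinearMap_le _)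

/-- A function on which the two isometries are as correlated as possible is invariant along almost
every step of the random iteration: this is the equality case of the Cauchy–Schwarz inequality. -/
lemma ae_invariant_of_inner_eq (hν : Stationary μ ν) {f : Lp ℝ 2 ν}
    (h : inner ℝ (sndIsometry μ ν f) (evalIsometry hν f) = ‖f‖ ^ 2) :
    ∀ᵐ p ∂μ.prod ν, f (p.1 p.2) = f p.2 := by
  have h1 : evalIsometry hν f = sndIsometry μ ν f := by
    rw [← sub_eq_zero, ← norm_eq_zero, ← sq_eq_zero_iff, norm_sub_sq_real,
      real_inner_comm, h, LinearIsometry.norm_map, LinearIsometry.norm_map]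
    ring
  filter_upwards [coeFn_evalIsometry hν f, coeFn_sndIsometry (μ := μ) f] with p hp1 hp2
  rw [← hp1, ← hp2, h1]

lemma ae_invariant_of_markovOp_eq (hν : Stationary μ ν) {f : Lp ℝ 2 ν}
    (h : markovOp hν f = f) : ∀ᵐ p ∂μ.prod ν, f (p.1 p.2) = f p.2 := by
  apply ae_invariant_of_inner_eq hν
  rw [← inner_markovOp, h, real_inner_self_eq_norm_sq]

lemma markovOp_toLp (hν : Stationary μ ν) {q : I → ℝ} (hq : MemLp q 2 ν)
    (hPq : MemLp (fun x ↦ ∫ g, q (g x) ∂μ) 2 ν) :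
    markovOp hν (hq.toLp q) = hPq.toLp _ := by
  refine ext_inner_left ℝ fun u ↦ ?_
  rw [inner_markovOp]
  have hint := L2.integrable_inner (𝕜 := ℝ) (sndIsometry μ ν u) (evalIsometry hν (hq.toLp q))
  have hae : (fun p ↦ inner ℝ (sndIsometry μ ν u p) (evalIsometry hν (hq.toLp q) p))
      =ᵐ[μ.prod ν] fun p ↦ q (p.1 p.2) * u p.2 := by
    filter_upwards [coeFn_evalIsometry hν (hq.toLp q), coeFn_sndIsometry (μ := μ) u,
      hν.quasiMeasurePreserving.ae_eq_comp hq.coeFn_toLp] with p h1 h2 h3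
    rw [h1, h2]
    have h4 : hq.toLp q (p.1 p.2) = q (p.1 p.2) := h3
    rw [h4]
    simp
  rw [L2.inner_def, integral_congr_ae hae, L2.inner_def,
    integral_prod_symm _ ((integrable_congr hae).1 hint)]
  refine integral_congr_ae ?_
  filter_upwards [hPq.coeFn_toLp] with x hx
  rw [hx]
  simp [integral_mul_const]

end Markov

/-! ### Compositions of independent maps -/

lemma measurable_compSeq (n : ℕ) : Measurable fun ω : ℕ → C(I, I) ↦ compSeq ω n := by
  induction n with
  | zero => exact measurable_const
  | succ n ih =>
    have h : Continuous fun p : C(I, I) × C(I, I) ↦ p.1.comp p.2 :=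
      ContinuousMap.continuous_comp'.comp continuous_swap
    exact h.measurable.comp (ih.prodMk (measurable_pi_apply n))

lemma measurable_compSeq_apply (n : ℕ) :
    Measurable fun p : (ℕ → C(I, I)) × I ↦ compSeq p.1 n p.2 :=
  measurable_evalMap.comp (((measurable_compSeq n).comp measurable_fst).prodMk measurable_snd)

lemma compSeq_congr {ω ω' : ℕ → C(I, I)} {n : ℕ} (h : ∀ i < n, ω i = ω' i) :
    compSeq ω n = compSeq ω' n := by
  induction n with
  | zero => rfl
  | succ n ih =>
    simp only [compSeq]
    rw [ih fun i hi ↦ h i (by omega), h n (by omega)]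

/-- The map `ω n` is independent of the composition of the maps before it. -/
lemma map_prodMk_compSeq (μ : Measure C(I, I)) [IsProbabilityMeasure μ] (n : ℕ) :
    (Measure.infinitePi fun _ : ℕ ↦ μ).map (fun ω ↦ (ω n, compSeq ω n)) =
      μ.prod ((Measure.infinitePi fun _ : ℕ ↦ μ).map fun ω ↦ compSeq ω n) := by
  have hind : iIndepFun (fun (i : ℕ) (ω : ℕ → C(I, I)) ↦ ω i)
      (Measure.infinitePi fun _ : ℕ ↦ μ) :=
    iIndepFun_infinitePi (X := fun _ ω ↦ ω) fun _ ↦ measurable_id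
  have h1 := hind.indepFun_finset {n} (Finset.range n) (by simp) fun i ↦ measurable_pi_apply i
  let ext (a : Finset.range n → C(I, I)) (i : ℕ) : C(I, I) :=
    if h : i ∈ Finset.range n then a ⟨i, h⟩ else ContinuousMap.id I
  have hext : Measurable ext := by
    refine measurable_pi_lambda _ fun i ↦ ?_
    by_cases h : i ∈ Finset.range n
    · simpa only [ext, h, dite_true] using measurable_pi_apply _
    · simpa only [ext, h, dite_false] using measurable_const
  have h2 : IndepFun (fun ω : ℕ → C(I, I) ↦ ω n) (fun ω ↦ compSeq ω n)
      (Measure.infinitePi fun _ : ℕ ↦ μ) := by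
    have hpi : Measurable fun a : ({n} : Finset ℕ) → C(I, I) ↦
        a ⟨n, Finset.mem_singleton_self n⟩ := measurable_pi_apply _
    have h3 := h1.comp hpi (ψ := fun a ↦ compSeq (ext a) n) ((measurable_compSeq n).comp hext)
    have h4 (ω : ℕ → C(I, I)) : compSeq (ext fun i ↦ ω i) n = compSeq ω n :=
      compSeq_congr fun i hi ↦ by simp [ext, hi]
    simpa only [Function.comp_def, h4] using h3
  rw [(indepFun_iff_map_prod_eq_prod_map_map (measurable_pi_apply n).aemeasurable
    (measurable_compSeq n).aemeasurable).1 h2, Measure.infinitePi_map_eval]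

/-- The probability that the random composition of `n` independent maps takes `x` outside `K`. -/
noncomputable def escapeProb (μ : Measure C(I, I)) (K : Set I) (n : ℕ) (x : I) : ℝ :=
  (Measure.infinitePi fun _ : ℕ ↦ μ).real {ω | compSeq ω n x ∉ K}

section Escape

variable {μ : Measure C(I, I)} [IsProbabilityMeasure μ] {K : Set I}

lemma escapeProb_nonneg {μ : Measure C(I, I)} (n : ℕ) (x : I) : 0 ≤ escapeProb μ K n x :=
  measureReal_nonneg

lemma escapeProb_le_one (n : ℕ) (x : I) : escapeProb μ K n x ≤ 1 := measureReal_le_one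

lemma measurable_escapeProb (hK : MeasurableSet K) (n : ℕ) : Measurable (escapeProb μ K n) :=
  (measurable_measure_prodMk_right (μ := Measure.infinitePi fun _ : ℕ ↦ μ)
    (measurable_compSeq_apply n hK.compl)).ennreal_toReal

lemma escapeProb_zero (x : I) : escapeProb μ K 0 x = Kᶜ.indicator 1 x := by
  by_cases hx : x ∈ K <;> simp [escapeProb, compSeq, hx]

lemma escapeProb_succ (hK : MeasurableSet K) (n : ℕ) (x : I) :
    escapeProb μ K (n + 1) x = ∫ g, escapeProb μ K n (g x) ∂μ := by
  have hx : Measurable fun g : C(I, I) ↦ g x :=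
    measurable_evalMap.comp (measurable_id.prodMk measurable_const)
  have hS : MeasurableSet {p : C(I, I) × C(I, I) | p.2 (p.1 x) ∉ K} :=
    measurable_evalMap.comp (measurable_snd.prodMk (hx.comp measurable_fst)) hK.compl
  have h1 : (Measure.infinitePi fun _ : ℕ ↦ μ) {ω | compSeq ω (n + 1) x ∉ K} =
      ∫⁻ g, (Measure.infinitePi fun _ : ℕ ↦ μ) {ω | compSeq ω n (g x) ∉ K} ∂μ := by
    have h2 := Measure.map_apply (μ := Measure.infinitePi fun _ : ℕ ↦ μ)
      ((measurable_pi_apply n).prodMk (measurable_compSeq n)) hS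
    rw [map_prodMk_compSeq, Measure.prod_apply hS] at h2
    refine h2.symm.trans (lintegral_congr fun g ↦ ?_)
    rw [Measure.map_apply (measurable_compSeq n) (measurable_prodMk_left hS)]
    rfl
  rw [escapeProb, measureReal_def, h1, ← integral_toReal]
  · rfl
  · exact ((measurable_measure_prodMk_right (μ := Measure.infinitePi fun _ : ℕ ↦ μ)
      (measurable_compSeq_apply n hK.compl)).comp hx).aemeasurable
  · exact ae_of_all _ fun g ↦ measure_lt_top _ _

variable {ν : Measure I} [IsFiniteMeasure ν]

lemma memLp_escapeProb (hK : MeasurableSet K) (n : ℕ) : MemLp (escapeProb μ K n) 2 ν :=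
  MemLp.of_bound (measurable_escapeProb hK n).aestronglyMeasurable 1 <| ae_of_all _ fun x ↦ by
    rw [Real.norm_of_nonneg (escapeProb_nonneg n x)]
    exact escapeProb_le_one n x

lemma markovOp_iterate_escapeProb (hν : Stationary μ ν) (hK : MeasurableSet K) (n : ℕ) :
    (markovOp hν)^[n] ((memLp_escapeProb (μ := μ) hK 0).toLp _) =
      (memLp_escapeProb (μ := μ) hK n).toLp _ := by
  induction n with
  | zero => rfl
  | succ n ih =>
    have h : (fun x : I ↦ ∫ g, escapeProb μ K n (g x) ∂μ) = escapeProb μ K (n + 1) :=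
      funext fun x ↦ (escapeProb_succ hK n x).symm
    rw [Function.iterate_succ_apply', ih,
      markovOp_toLp hν (memLp_escapeProb hK n) (h ▸ memLp_escapeProb hK (n + 1))]
    simp only [h]

/-! ### An ergodic component that rarely leaves a large set -/

/-- If `K` carries most of the mass of a stationary measure `ν`, then some almost invariant set
`E` of positive measure consists of points whose random orbits spend, on time average, little time
outside `K`. This holds uniformly with respect to the starting distribution on `E`: averages over
the part of `E` in any set `U` are eventually below the same `η`. -/
lemma exists_restrict_cesaro_lt (hν : Stationary μ ν) (hK : MeasurableSet K) {η : ℝ}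
    (hη : ν.real Kᶜ < η * ν.real Set.univ) :
    ∃ E : Set I, MeasurableSet E ∧ ν E ≠ 0 ∧ Stationary μ (ν.restrict E) ∧
      ∀ U, MeasurableSet U → ν.restrict E U ≠ 0 →
        ∀ᶠ N : ℕ in atTop, (N : ℝ)⁻¹ *
          ∑ n ∈ Finset.range N, ⨍ x in U, escapeProb μ K n x ∂(ν.restrict E) < η := by
  set b : Lp ℝ 2 ν := (memLp_escapeProb (μ := μ) hK 0).toLp _ with hb
  -- The mean ergodic theorem gives the limit `φ` of the time averages.
  set S := (markovOp hν).eqLocus (1 : Lp ℝ 2 ν →L[ℝ] Lp ℝ 2 ν) with hS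
  set φ : Lp ℝ 2 ν := (S.orthogonalProjectionOnto b : Lp ℝ 2 ν) with hφ
  have hlim := (markovOp hν).tendsto_birkhoffAverage_orthogonalProjection
    (norm_markovOp_le hν) b
  have hφP : markovOp hν φ = φ := (S.orthogonalProjectionOnto b).2
  have hφinv := ae_invariant_of_markovOp_eq hν hφP
  have hφm : Measurable φ := (Lp.stronglyMeasurable φ).measurable
  have hφi : Integrable φ ν := (Lp.memLp φ).integrable one_le_two
  have hset : ∀ U : Set I, MeasurableSet U →
      Tendsto (fun N : ℕ ↦ (N : ℝ)⁻¹ * ∑ n ∈ Finset.range N, ∫ x in U, escapeProb μ K n x ∂ν)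
        atTop (𝓝 (∫ x in U, φ x ∂ν)) := by
    intro U hU
    have h1 := (continuous_const.inner continuous_id (𝕜 := ℝ)
      (f := fun _ ↦ indicatorConstLp 2 hU (measure_ne_top ν U) (1 : ℝ))).tendsto φ |>.comp hlim
    simp only [id, L2.inner_indicatorConstLp_one] at h1
    refine h1.congr fun N ↦ ?_
    simp only [Function.comp_apply]
    rw [← L2.inner_indicatorConstLp_one hU (measure_ne_top ν U), birkhoffAverage, birkhoffSum,
      inner_smul_right, inner_sum]
    congr 1
    refine Finset.sum_congr rfl fun n _ ↦ ?_
    rw [id, markovOp_iterate_escapeProb hν hK n, L2.inner_indicatorConstLp_one]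
    exact integral_congr_ae (ae_restrict_of_ae (memLp_escapeProb hK n).coeFn_toLp)
  -- Time averaging does not change the mean.
  have hmean : ∀ n, ∫ x, escapeProb μ K n x ∂ν = ν.real Kᶜ := by
    intro n
    induction n with
    | zero => simp [escapeProb_zero, integral_indicator_one hK.compl]
    | succ n ih =>
      have h1 : Integrable (fun p : C(I, I) × I ↦ escapeProb μ K n (evalMap p)) (μ.prod ν) :=
        hν.integrable_comp_of_integrable ((memLp_escapeProb hK n).integrable one_le_two)
      rw [← ih]
      conv_rhs => rw [← hν.map_eq]
      rw [integral_map measurable_evalMap.aemeasurable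
        (measurable_escapeProb hK n).aestronglyMeasurable, integral_prod_symm _ h1]
      simp only [escapeProb_succ hK]
      rfl
  have hφint : ∫ x, φ x ∂ν = ν.real Kᶜ := by
    have h1 := hset Set.univ MeasurableSet.univ
    simp only [Measure.restrict_univ, hmean] at h1
    refine tendsto_nhds_unique h1 (tendsto_const_nhds.congr' ?_)
    filter_upwards [eventually_ne_atTop 0] with N hN
    simp
    field_simp
  refine ⟨φ ⁻¹' Set.Iio η, hφm measurableSet_Iio, fun h0 ↦ ?_,
    hν.restrict (hφm measurableSet_Iio) ?_, fun V hV hV0 ↦ ?_⟩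
  · have h1 : ∀ᵐ x ∂ν, η ≤ φ x := by
      have : ∀ᵐ x ∂ν, x ∉ φ ⁻¹' Set.Iio η := measure_eq_zero_iff_ae_notMem.1 h0
      filter_upwards [this] with x hx
      simpa using hx
    have h2 := integral_mono_ae (integrable_const η) hφi h1
    rw [hφint, integral_const, smul_eq_mul] at h2
    linarith [mul_comm η (ν.real Set.univ)]
  · filter_upwards [hφinv] with p hp
    simp [hp]
  · rw [Measure.restrict_apply hV] at hV0
    rw [Measure.restrict_restrict hV]
    have hU : MeasurableSet (V ∩ φ ⁻¹' Set.Iio η) := hV.inter (hφm measurableSet_Iio)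
    have hUE : V ∩ φ ⁻¹' Set.Iio η ⊆ φ ⁻¹' Set.Iio η := Set.inter_subset_right
    generalize V ∩ φ ⁻¹' Set.Iio η = U at *
    have hUpos : 0 < ν.real U := ENNReal.toReal_pos hV0 (measure_ne_top _ _)
    have hlt : ∫ x in U, φ x ∂ν < η * ν.real U := by
      have h1 : 0 < ∫ x in U, (η - φ x) ∂ν := by
        rw [setIntegral_pos_iff_support_of_nonneg_ae]
        · have : Function.support (fun x ↦ η - φ x) ∩ U = U := by
            refine Set.inter_eq_right.2 fun x hx ↦ ?_
            have : φ x < η := hUE hx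
            exact (sub_pos.2 this).ne'
          rw [this]
          exact pos_iff_ne_zero.2 hV0
        · filter_upwards [ae_restrict_mem hU] with x hx
          have : φ x < η := hUE hx
          exact (sub_pos.2 this).le
        · exact ((integrable_const η).sub hφi).integrableOn
      rw [integral_sub (integrable_const η) hφi.integrableOn, setIntegral_const, smul_eq_mul] at h1
      linarith [mul_comm η (ν.real U)]
    filter_upwards [(hset U hU).eventually (gt_mem_nhds hlt)] with N hN
    simp only [setAverage_eq, smul_eq_mul, ← Finset.mul_sum]
    rw [mul_left_comm, inv_mul_lt_iff₀ hUpos, mul_comm _ η]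
    exact hN

end Escape

/-! ### Splitting off invariant sets -/

/-- Two different stationary probability measures yield an almost surely invariant set `A` such that
both `A` and its complement are charged. The density of `ν₁` with respect to `ν₁ + ν₂` is invariant
along the random iteration, and `A` is one of its superlevel sets. -/
lemma exists_invariant_set {μ : Measure C(I, I)} [IsProbabilityMeasure μ] {ν₁ ν₂ : Measure I}
    [IsProbabilityMeasure ν₁] [IsProbabilityMeasure ν₂] (h₁ : Stationary μ ν₁)
    (h : Stationary μ (ν₁ + ν₂)) (hne : ν₁ ≠ ν₂) :
    ∃ A : Set I, MeasurableSet A ∧ (ν₁ + ν₂) A ≠ 0 ∧ (ν₁ + ν₂) Aᶜ ≠ 0 ∧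
      ∀ᵐ p ∂μ.prod (ν₁ + ν₂), p.1 p.2 ∈ A ↔ p.2 ∈ A := by
  set ν := ν₁ + ν₂ with hν
  have : IsFiniteMeasure ν := hν ▸ inferInstance
  have : ν₁.HaveLebesgueDecomposition ν := Measure.haveLebesgueDecomposition_of_sigmaFinite _ _
  have hac : ν₁ ≪ ν := Measure.absolutelyContinuous_of_le (Measure.le_add_right le_rfl)
  set f : I → ℝ := fun x ↦ (ν₁.rnDeriv ν x).toReal with hf
  have hfm : Measurable f := (Measure.measurable_rnDeriv _ _).ennreal_toReal
  have hf1 : ∀ᵐ x ∂ν, ‖f x‖ ≤ 1 := by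
    filter_upwards [Measure.rnDeriv_le_one_of_le (Measure.le_add_right le_rfl : ν₁ ≤ ν)] with x hx
    rw [Real.norm_of_nonneg ENNReal.toReal_nonneg]
    exact ENNReal.toReal_le_of_le_ofReal zero_le_one (by simpa using hx)
  have hfL : MemLp f 2 ν := MemLp.of_bound hfm.aestronglyMeasurable 1 hf1
  have hfi : Integrable f ν := hfL.integrable one_le_two
  have hfi₁ : Integrable f ν₁ := Integrable.of_bound hfm.aestronglyMeasurable 1 (hac.ae_le hf1)
  have hinner : inner ℝ (sndIsometry μ ν (hfL.toLp f)) (evalIsometry h (hfL.toLp f)) =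
      ‖hfL.toLp f‖ ^ 2 := by
    have hint := L2.integrable_inner (𝕜 := ℝ) (sndIsometry μ ν (hfL.toLp f))
      (evalIsometry h (hfL.toLp f))
    have hae : (fun p ↦ inner ℝ (sndIsometry μ ν (hfL.toLp f) p) (evalIsometry h (hfL.toLp f) p))
        =ᵐ[μ.prod ν] fun p ↦ f p.2 • f (evalMap p) := by
      filter_upwards [coeFn_evalIsometry h (hfL.toLp f), coeFn_sndIsometry (μ := μ) (hfL.toLp f),
        h.quasiMeasurePreserving.ae_eq_comp hfL.coeFn_toLp,
        measurePreserving_snd.quasiMeasurePreserving.ae_eq_comp hfL.coeFn_toLp] with p h1 h2 h3 h4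
      have h5 : hfL.toLp f (p.1 p.2) = f (evalMap p) := h3
      have h6 : hfL.toLp f p.2 = f p.2 := h4
      rw [h1, h2, h5, h6]
      simp [mul_comm]
    rw [L2.inner_def, integral_congr_ae hae, integral_prod _ ((integrable_congr hae).1 hint),
      ← real_inner_self_eq_norm_sq, L2.inner_def]
    have e1 : ∫ g, ∫ x, f x • f (evalMap (g, x)) ∂ν ∂μ = ∫ g, ∫ x, f (evalMap (g, x)) ∂ν₁ ∂μ :=
      integral_congr_ae (ae_of_all _ fun g ↦ integral_rnDeriv_smul hac)
    have e2 : ∫ g, ∫ x, f (evalMap (g, x)) ∂ν₁ ∂μ = ∫ x, f x ∂ν₁ := by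
      rw [← integral_prod (fun p ↦ f (evalMap p)) (h₁.integrable_comp_of_integrable hfi₁)]
      conv_rhs => rw [← h₁.map_eq]
      rw [integral_map measurable_evalMap.aemeasurable hfm.aestronglyMeasurable]
    have e3 : ∫ x, f x • f x ∂ν = ∫ x, f x ∂ν₁ := integral_rnDeriv_smul hac
    rw [e1, e2, ← e3]
    refine integral_congr_ae ?_
    filter_upwards [hfL.coeFn_toLp] with x hx
    rw [hx]
    simp [sq]
  have hinv : ∀ᵐ p ∂μ.prod ν, f (p.1 p.2) = f p.2 := by
    filter_upwards [ae_invariant_of_inner_eq h hinner,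
      h.quasiMeasurePreserving.ae_eq_comp hfL.coeFn_toLp,
      measurePreserving_snd.quasiMeasurePreserving.ae_eq_comp hfL.coeFn_toLp] with p h1 h2 h3
    exact (h2.symm.trans h1).trans h3
  -- If the density is constant, then it is `1 / 2`, and the two measures coincide.
  have hconst : ¬ f =ᵐ[ν] fun _ ↦ 1 / 2 := by
    intro hc
    refine hne (Measure.ext fun s hs ↦ ?_)
    have e1 : ∫ x in s, f x ∂ν = ν₁.real s := Measure.setIntegral_toReal_rnDeriv hac s
    rw [integral_congr_ae (ae_restrict_of_ae hc), setIntegral_const, hν,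
      measureReal_add_apply, smul_eq_mul] at e1
    exact (measureReal_eq_measureReal_iff).1 (by linarith)
  have hmean : ∫ x, (f x - 1 / 2) ∂ν = 0 := by
    rw [integral_sub hfi (integrable_const _), Measure.integral_toReal_rnDeriv hac,
      integral_const, hν, measureReal_add_apply]
    norm_num
  refine ⟨f ⁻¹' Set.Ioi (1 / 2), hfm measurableSet_Ioi, fun h0 ↦ hconst ?_, fun h0 ↦ hconst ?_, ?_⟩
  · have h1 : 0 ≤ᵐ[ν] fun x ↦ 1 / 2 - f x := by
      filter_upwards [measure_eq_zero_iff_ae_notMem.1 h0] with x hx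
      simpa using hx
    have h2 : ∫ x, (1 / 2 - f x) ∂ν = 0 := by
      rw [← neg_eq_zero, ← integral_neg, ← hmean]
      simp
    filter_upwards [(integral_eq_zero_iff_of_nonneg_ae h1 ((integrable_const _).sub hfi)).1 h2]
      with x hx
    exact (sub_eq_zero.1 hx).symm
  · have h1 : 0 ≤ᵐ[ν] fun x ↦ f x - 1 / 2 := by
      filter_upwards [measure_eq_zero_iff_ae_notMem.1 h0] with x hx
      have : 1 / 2 < f x := by simpa using hx
      exact (sub_pos.2 this).le
    filter_upwards [(integral_eq_zero_iff_of_nonneg_ae h1 (hfi.sub (integrable_const _))).1 hmean]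
      with x hx
    exact sub_eq_zero.1 hx
  · filter_upwards [hinv] with p hp
    simp [hp]

/-! ### Escape towards an end of the interval -/

section Escape

variable {μ : Measure C(I, I)} [IsProbabilityMeasure μ] {ν : Measure I} [IsFiniteMeasure ν]

/-- If every interior point can be moved towards the end `τ = 1` of the interval, then a stationary
measure carried by the interior charges every neighbourhood of that end. The cases of interest are
`τ = id` and `τ = unitInterval.symm`. The point of the support closest to the end cannot be an
interior point. -/
lemma Stationary.measure_lt_ne_zero {μ : Measure C(I, I)} (hν : Stationary μ ν) (hν0 : ν ≠ 0)
    (hνI : ν (Set.Ioo 0 1)ᶜ = 0) {τ : I → I} (hτ : Continuous τ)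
    (hτI : ∀ x, τ x ∈ Set.Ioo (0 : I) 1 ↔ x ∈ Set.Ioo (0 : I) 1)
    (hU : ∀ x ∈ Set.Ioo (0 : I) 1, ∃ g ∈ μ.support, τ x < τ (g x)) {a : I} (ha : a < 1) :
    ν {x | a < τ x} ≠ 0 := by
  obtain ⟨x₀, hx₀, hmax⟩ := Measure.isClosed_support (μ := ν).isCompact.exists_isMaxOn
    (Measure.nonempty_support hν0) hτ.continuousOn
  have hnull : ν {x | τ x₀ < τ x} = 0 := by
    refine measure_mono_null (t := ν.supportᶜ) (fun x hx hxS ↦ ?_)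
      (Measure.measure_compl_support (μ := ν))
    exact not_lt_of_ge (hmax hxS) (show τ x₀ < τ x from hx)
  have h1 : τ x₀ = 1 := by
    by_contra hne1
    have hne0 : τ x₀ ≠ 0 := by
      intro h0
      refine hν0 (Measure.measure_univ_eq_zero.1 ?_)
      refine measure_mono_null (t := {x | τ x₀ < τ x} ∪ (Set.Ioo 0 1)ᶜ) (fun x _ ↦ ?_)
        (measure_union_null hnull hνI)
      by_cases hx : x ∈ Set.Ioo (0 : I) 1
      · exact Or.inl (h0 ▸ ((hτI x).2 hx).1)
      · exact Or.inr hx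
    obtain ⟨g, hg, hgx⟩ := hU x₀
      ((hτI x₀).1 ⟨unitInterval.pos_iff_ne_zero.2 hne0, unitInterval.lt_one_iff_ne_one.2 hne1⟩)
    have hopen : IsOpen {p : C(I, I) × I | τ x₀ < τ (evalMap p)} :=
      isOpen_lt continuous_const (hτ.comp continuous_evalMap)
    obtain ⟨B, W, hB, hW, hgB, hxW, hsub⟩ := isOpen_prod_iff.1 hopen g x₀ hgx
    have hpos : 0 < (μ.prod ν) (B ×ˢ W) := by
      rw [Measure.prod_prod]
      exact ENNReal.mul_pos
        ((Measure.mem_support_iff_forall g).1 hg B (hB.mem_nhds hgB)).ne'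
        ((Measure.mem_support_iff_forall x₀).1 hx₀ W (hW.mem_nhds hxW)).ne'
    have hzero : (μ.prod ν) {p : C(I, I) × I | τ x₀ < τ (evalMap p)} = 0 := by
      rw [← hν.measure_preimage (isOpen_lt continuous_const hτ).measurableSet.nullMeasurableSet]
        at hnull
      exact hnull
    exact (hpos.trans_le (measure_mono hsub)).ne' hzero
  exact ((Measure.mem_support_iff_forall x₀).1 hx₀ _
    ((isOpen_lt continuous_const hτ).mem_nhds (show a < τ x₀ from h1 ▸ ha))).ne'

lemma Stationary.exists_measure_Ioc_ne_zero {μ : Measure C(I, I)} (hν : Stationary μ ν)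
    (hν0 : ν ≠ 0)
    (hνI : ν (Set.Ioo 0 1)ᶜ = 0) {τ : I → I} (hτ : Continuous τ)
    (hτI : ∀ x, τ x ∈ Set.Ioo (0 : I) 1 ↔ x ∈ Set.Ioo (0 : I) 1)
    (hU : ∀ x ∈ Set.Ioo (0 : I) 1, ∃ g ∈ μ.support, τ x < τ (g x)) {a : I} (ha : a < 1) :
    ∃ b < 1, ν (τ ⁻¹' Set.Ioc a b) ≠ 0 := by
  by_contra! hcon
  obtain ⟨u, -, hu, hlim⟩ := exists_seq_strictMono_tendsto' ha
  refine hν.measure_lt_ne_zero hν0 hνI hτ hτI hU ha ?_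
  refine measure_mono_null (t := (⋃ n, τ ⁻¹' Set.Ioc a (u n)) ∪ (Set.Ioo 0 1)ᶜ) (fun x hx ↦ ?_)
    (measure_union_null (measure_iUnion_null fun n ↦ hcon _ (hu n).2) hνI)
  by_cases hxI : x ∈ Set.Ioo (0 : I) 1
  · obtain ⟨n, hn⟩ := (hlim.eventually (lt_mem_nhds ((hτI x).2 hxI).2)).exists
    exact Or.inl (Set.mem_iUnion.2 ⟨n, hx, hn.le⟩)
  · exact Or.inr hxI

end Escape

/-! ### Bounded variation against alternating orbits -/

lemma sum_edist_le_variation (f : C(I, I)) {z : ℕ → I} (hz : Monotone z) (n : ℕ) :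
    ∑ k ∈ Finset.range n, edist (f (z (k + 1))) (f (z k)) ≤ variation f :=
  eVariationOn.sum_le hz fun _ ↦ Set.mem_univ _

lemma sum_edist_le_variation_of_antitone (f : C(I, I)) {z : ℕ → I} (hz : Antitone z) (n : ℕ) :
    ∑ k ∈ Finset.range n, edist (f (z (k + 1))) (f (z k)) ≤ variation f := by
  have h1 := eVariationOn.sum_le (f := f ∘ unitInterval.symm) (s := Set.univ) (n := n)
    (u := fun k ↦ unitInterval.symm (z k)) (fun i j hij ↦ unitInterval.symm_le_symm.2 (hz hij))
    fun _ ↦ Set.mem_univ _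
  have h2 := eVariationOn.comp_eq_of_antitoneOn (⇑f) (t := Set.univ) unitInterval.symm
    fun _ _ _ _ h ↦ unitInterval.symm_le_symm.2 h
  rw [Set.image_univ, unitInterval.symm_bijective.surjective.range_eq] at h2
  rw [h2] at h1
  simpa [variation] using h1

/-- Condition (BV) bounds the variations of all compositions by one constant, on an event of
positive outer probability. The bound is made to include the empty composition. -/
lemma BV.exists_bound {μ : Measure C(I, I)} (h : BV μ) :
    ∃ V : ℕ, Measure.infinitePi (fun _ : ℕ ↦ μ) {ω | ∀ n, variation (compSeq ω n) ≤ V} ≠ 0 := by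
  by_contra! hcon
  refine h.ne' (measure_mono_null (fun ω hω ↦ ?_) (measure_iUnion_null hcon))
  have hid : variation (.id I) < ∞ := by
    have h1 := (show Monotone fun x : I ↦ (x : ℝ) from fun _ _ h ↦ h).monotoneOn
      Set.univ |>.eVariationOn_eq (Set.mem_univ 0) (Set.mem_univ 1)
    have h2 : Set.univ ∩ Set.Icc (0 : I) 1 = Set.univ :=
      Set.eq_univ_of_forall fun x ↦ ⟨trivial, x.2.1, x.2.2⟩
    rw [h2] at h1
    exact (show variation (.id I) = _ from h1).trans_lt ENNReal.ofReal_lt_top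
  obtain ⟨V, hV⟩ := ENNReal.exists_nat_gt (max_lt hω.2 hid).ne
  refine Set.mem_iUnion.2 ⟨V, fun n ↦ ?_⟩
  rcases n.eq_zero_or_pos with rfl | hn
  · exact (le_max_right _ _).trans hV.le
  · exact (le_iSup₂ (f := fun n (_ : 1 ≤ n) ↦ variation (compSeq ω n)) n hn).trans
      ((le_max_left _ _).trans hV.le)

/-- Condition (BV) rules out alternation. Let each measure `κ k` charge every neighbourhood of the
end `τ = 1` away from the end itself, and let the orbits started from any part of `κ k` spend a
large proportion of their time in `K k`, where consecutive sets `K k` and `K (k + 1)` are at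
distance at least `δ`. For points `z 0, …, z m` in successive intervals, at some common time most
of them are in their sets with high probability, and the variation of the composition is then of
order `m * δ`. -/
lemma not_alternating {μ : Measure C(I, I)} [IsProbabilityMeasure μ] {V : ℕ} {η : ℝ} (hη : 0 < η)
    (hV : 8 * η ≤ (Measure.infinitePi fun _ : ℕ ↦ μ).real
      {ω | ∀ n, variation (compSeq ω n) ≤ V})
    {τ : I → I} (hτ : Measurable τ)
    (hτV : ∀ (f : C(I, I)) (z : ℕ → I), Monotone (τ ∘ z) → ∀ n,
      ∑ k ∈ Finset.range n, edist (f (z (k + 1))) (f (z k)) ≤ variation f)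
    (κ : ℕ → Measure I) [∀ k, IsFiniteMeasure (κ k)]
    (hκ : ∀ k, ∀ a < 1, ∃ b < 1, κ k (τ ⁻¹' Set.Ioc a b) ≠ 0)
    (K : ℕ → Set I) (hK : ∀ k, MeasurableSet (K k)) {δ : ℝ} (hδ : 0 < δ)
    (hKδ : ∀ k, ∀ x ∈ K k, ∀ y ∈ K (k + 1), δ ≤ dist y x)
    (hces : ∀ k U, MeasurableSet U → κ k U ≠ 0 → ∀ᶠ N : ℕ in atTop,
      (N : ℝ)⁻¹ * ∑ n ∈ Finset.range N, ⨍ x in U, escapeProb μ (K k) n x ∂(κ k) < η) :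
    False := by
  choose! next hnext1 hnext using hκ
  let a : ℕ → I := fun k ↦ k.rec 0 next
  have ha1 : ∀ k, a k < 1 := fun k ↦ by
    induction k with
    | zero => exact zero_lt_one
    | succ k ih => exact hnext1 k _ ih
  set U : ℕ → Set I := fun k ↦ τ ⁻¹' Set.Ioc (a k) (a (k + 1)) with hU
  have hUm : ∀ k, MeasurableSet (U k) := fun k ↦ hτ measurableSet_Ioc
  have hU0 : ∀ k, κ k (U k) ≠ 0 := fun k ↦ hnext k _ (ha1 k)
  -- With at most `m / 4` bad points, at least `m / 2` pairs of consecutive points are mapped to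
  -- distance at least `δ`, so `V < m * δ / 2` makes the variation too large.
  obtain ⟨m, hm⟩ := exists_nat_gt (max 1 (2 * V / δ))
  have hm1 : (1 : ℝ) < m := (le_max_left _ _).trans_lt hm
  have hmV : 2 * V < m * δ := (div_lt_iff₀ hδ).1 ((le_max_right _ _).trans_lt hm)
  -- A time at which all the starting distributions behave well on average.
  obtain ⟨n, hn⟩ : ∃ n, ∑ k ∈ Finset.range (m + 1), ⨍ x in U k, escapeProb μ (K k) n x ∂(κ k) <
      (m + 1) * η := by
    have h1 : ∀ᶠ N : ℕ in atTop, ∀ k ∈ Finset.range (m + 1), (N : ℝ)⁻¹ *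
        ∑ n ∈ Finset.range N, ⨍ x in U k, escapeProb μ (K k) n x ∂(κ k) < η :=
      (Finset.eventually_all _).2 fun k _ ↦ hces k _ (hUm k) (hU0 k)
    obtain ⟨N, hN, hN0⟩ := (h1.and (eventually_gt_atTop 0)).exists
    have hN0' : (0 : ℝ) < N := Nat.cast_pos.2 hN0
    have h2 := Finset.sum_lt_sum_of_nonempty (Finset.nonempty_range_add_one (n := m)) hN
    rw [← Finset.mul_sum, Finset.sum_comm, inv_mul_lt_iff₀ hN0'] at h2
    obtain ⟨n, -, hn⟩ := Finset.exists_lt_of_sum_lt (s := Finset.range N)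
      (g := fun _ ↦ (m + 1) * η) (h2.trans_eq (by simp))
    exact ⟨n, hn⟩
  -- Starting points that are at least as good as the average.
  have hz : ∀ k, ∃ x ∈ U k,
      escapeProb μ (K k) n x ≤ ⨍ x in U k, escapeProb μ (K k) n x ∂(κ k) := fun k ↦
    exists_le_setAverage (hU0 k) (measure_ne_top _ _)
      (((memLp_escapeProb (hK k) n).integrable one_le_two).integrableOn)
  choose z hzU hz using hz
  have hzmono : Monotone (τ ∘ z) :=
    monotone_nat_of_le_succ fun k ↦ (hzU k).2.trans (hzU (k + 1)).1.le
  -- The number of points that are not in their sets at time `n`.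
  set bad : ℕ → (ℕ → C(I, I)) → ℝ := fun k ↦ {ω | compSeq ω n (z k) ∉ K k}.indicator 1 with hbad
  have hbm : ∀ k, MeasurableSet {ω : ℕ → C(I, I) | compSeq ω n (z k) ∉ K k} := fun k ↦
    ((measurable_compSeq_apply n).comp (measurable_id.prodMk measurable_const)) (hK k).compl
  have hb0 : ∀ k ω, 0 ≤ bad k ω := fun k ω ↦ Set.indicator_nonneg (fun _ _ ↦ zero_le_one) _
  set D : (ℕ → C(I, I)) → ℝ := fun ω ↦ ∑ k ∈ Finset.range (m + 1), bad k ω with hD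
  have hbi : ∀ k, Integrable (bad k) (Measure.infinitePi fun _ : ℕ ↦ μ) := fun k ↦
    (integrable_const (1 : ℝ)).indicator (hbm k)
  have hDi : Integrable D (Measure.infinitePi fun _ : ℕ ↦ μ) :=
    integrable_finsetSum _ fun k _ ↦ hbi k
  have hDint : ∫ ω, D ω ∂(Measure.infinitePi fun _ : ℕ ↦ μ) < (m + 1) * η := by
    rw [integral_finsetSum _ fun k _ ↦ hbi k]
    refine (Finset.sum_le_sum fun k _ ↦ ?_).trans_lt hn
    refine le_trans (le_of_eq ?_) (hz k)
    exact integral_indicator_one (hbm k)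
  have hsub : {ω : ℕ → C(I, I) | ∀ n, variation (compSeq ω n) ≤ V} ⊆ {ω | (m : ℝ) / 4 ≤ D ω} := by
    intro ω hω
    have h1 := (hτV (compSeq ω n) z hzmono m).trans (hω n)
    simp_rw [edist_dist] at h1
    rw [← ENNReal.ofReal_sum_of_nonneg fun _ _ ↦ dist_nonneg, ← ENNReal.ofReal_natCast,
      ENNReal.ofReal_le_ofReal_iff (Nat.cast_nonneg V)] at h1
    have h2 : ∀ k ∈ Finset.range m, δ * (1 - bad k ω - bad (k + 1) ω) ≤
        dist (compSeq ω n (z (k + 1))) (compSeq ω n (z k)) := by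
      intro k _
      by_cases hk : compSeq ω n (z k) ∈ K k
      · by_cases hk' : compSeq ω n (z (k + 1)) ∈ K (k + 1)
        · have e1 : bad k ω = 0 := Set.indicator_of_notMem (by simpa using hk) _
          have e2 : bad (k + 1) ω = 0 := Set.indicator_of_notMem (by simpa using hk') _
          rw [e1, e2]
          simpa using hKδ k _ hk _ hk'
        · have e2 : bad (k + 1) ω = 1 := Set.indicator_of_mem (by simpa using hk') _
          refine le_trans ?_ dist_nonneg
          rw [e2]
          nlinarith [hb0 k ω]
      · have e1 : bad k ω = 1 := Set.indicator_of_mem (by simpa using hk) _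
        refine le_trans ?_ dist_nonneg
        rw [e1]
        nlinarith [hb0 (k + 1) ω]
    have h3 := (Finset.sum_le_sum h2).trans h1
    rw [← Finset.mul_sum, Finset.sum_sub_distrib, Finset.sum_sub_distrib] at h3
    have h4 : D ω = ∑ k ∈ Finset.range m, bad k ω + bad m ω := Finset.sum_range_succ _ _
    have h5 : D ω = ∑ k ∈ Finset.range m, bad (k + 1) ω + bad 0 ω := Finset.sum_range_succ' _ _
    simp only [Finset.sum_const, Finset.card_range, nsmul_eq_mul, mul_one] at h3
    have h6 : δ * (m - 2 * D ω) ≤ V :=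
      (mul_le_mul_of_nonneg_left (by linarith [hb0 m ω, hb0 0 ω]) hδ.le).trans h3
    show (m : ℝ) / 4 ≤ D ω
    by_contra! h7
    nlinarith
  have h1 := mul_meas_ge_le_integral_of_nonneg
    (ae_of_all _ fun ω ↦ Finset.sum_nonneg fun k _ ↦ hb0 k ω) hDi ((m : ℝ) / 4)
  have h2 := hV.trans (measureReal_mono hsub)
  nlinarith

/-! ### Existence of stationary measures -/

/-- The distribution after `n` steps of the random iteration started at `0`. -/
noncomputable def stepLaw (μ : Measure C(I, I)) : ℕ → Measure I
  | 0 => Measure.dirac 0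
  | n + 1 => (μ.prod (stepLaw μ n)).map evalMap

instance isProbabilityMeasure_stepLaw (μ : Measure C(I, I)) [IsProbabilityMeasure μ] (n : ℕ) :
    IsProbabilityMeasure (stepLaw μ n) := by
  induction n with
  | zero => exact Measure.dirac.isProbabilityMeasure
  | succ n ih => exact Measure.isProbabilityMeasure_map measurable_evalMap.aemeasurable

lemma integral_map_evalMap {μ : Measure C(I, I)} [IsProbabilityMeasure μ] (m : Measure I)
    [IsFiniteMeasure m] (f : BoundedContinuousFunction I ℝ) :
    ∫ x, f x ∂((μ.prod m).map evalMap) = ∫ x, ∫ g, f (g x) ∂μ ∂m := by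
  have h : Integrable (fun p ↦ f (evalMap p)) (μ.prod m) :=
    (f.integrable ((μ.prod m).map evalMap)).comp_measurable measurable_evalMap
  rw [integral_map measurable_evalMap.aemeasurable f.continuous.aestronglyMeasurable,
    integral_prod_symm _ h]
  rfl

/-- Stationary probability measures exist by the Krylov–Bogolyubov argument: every limit point of
the time averages of `stepLaw` is stationary, because the random iteration maps continuous functions
to continuous functions. -/
lemma exists_stationary (μ : Measure C(I, I)) [IsProbabilityMeasure μ] :
    ∃ ν : Measure I, IsProbabilityMeasure ν ∧ Stationary μ ν := by
  let avg (N : ℕ) : Measure I :=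
    ((N + 1 : ℕ) : ℝ≥0∞)⁻¹ • ∑ n ∈ Finset.range (N + 1), stepLaw μ n
  have havg (N : ℕ) : IsProbabilityMeasure (avg N) := ⟨by
    simp only [avg, Measure.smul_apply, Measure.finsetSum_apply, measure_univ, Finset.sum_const,
      Finset.card_range, nsmul_eq_mul, mul_one, smul_eq_mul]
    exact ENNReal.inv_mul_cancel (by simp) (by finiteness)⟩
  have hint (N : ℕ) (f : BoundedContinuousFunction I ℝ) : ∫ x, f x ∂(avg N) =
      ((N + 1 : ℕ) : ℝ)⁻¹ * ∑ n ∈ Finset.range (N + 1), ∫ x, f x ∂(stepLaw μ n) := by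
    rw [integral_smul_measure, integral_finsetSum_measure fun n _ ↦ f.integrable _]
    simp [-Nat.cast_add]
  let avgP (N : ℕ) : ProbabilityMeasure I := ⟨avg N, havg N⟩
  obtain ⟨ν, -, hν⟩ := isCompact_univ.ultrafilter_le_nhds
    ((hyperfilter ℕ).map avgP) (by simp)
  have hlim := ProbabilityMeasure.tendsto_iff_forall_integral_tendsto.1
    (show Tendsto avgP (hyperfilter ℕ) (𝓝 ν) from hν)
  refine ⟨ν, inferInstance, measurable_evalMap, ?_⟩
  have : IsProbabilityMeasure ((μ.prod (ν : Measure I)).map evalMap) :=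
    Measure.isProbabilityMeasure_map measurable_evalMap.aemeasurable
  refine ext_of_forall_integral_eq_of_IsFiniteMeasure fun f ↦ ?_
  have hcont : Continuous fun x : I ↦ ∫ g, f (g x) ∂μ := by
    refine continuous_of_dominated (bound := fun _ ↦ ‖f‖) (fun x ↦ ?_)
      (fun x ↦ ae_of_all _ fun g ↦ f.norm_coe_le_norm _) (integrable_const _)
      (ae_of_all _ fun g ↦ f.continuous.comp g.continuous)
    exact (f.continuous.comp (continuous_eval_const x)).aestronglyMeasurable
  let Pf : BoundedContinuousFunction I ℝ := BoundedContinuousFunction.mkOfCompact ⟨_, hcont⟩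
  rw [integral_map_evalMap]
  refine tendsto_nhds_unique (hlim Pf) ?_
  have hstep (n : ℕ) : ∫ x, Pf x ∂(stepLaw μ n) = ∫ x, f x ∂(stepLaw μ (n + 1)) :=
    (integral_map_evalMap _ f).symm
  -- The two time averages differ by a telescoping sum.
  have hdiff (N : ℕ) : ∫ x, Pf x ∂(avg N) = ∫ x, f x ∂(avg N) + ((N + 1 : ℕ) : ℝ)⁻¹ *
      (∫ x, f x ∂(stepLaw μ (N + 1)) - ∫ x, f x ∂(stepLaw μ 0)) := by
    rw [hint, hint, ← mul_add, ← Finset.sum_range_sub fun n ↦ ∫ x, f x ∂(stepLaw μ n),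
      ← Finset.sum_add_distrib]
    simp [hstep]
  have hsmall : Tendsto (fun N : ℕ ↦ ((N + 1 : ℕ) : ℝ)⁻¹ *
      (∫ x, f x ∂(stepLaw μ (N + 1)) - ∫ x, f x ∂(stepLaw μ 0))) atTop (𝓝 0) := by
    have hb (n : ℕ) : ‖∫ x, f x ∂(stepLaw μ n)‖ ≤ ‖f‖ := by
      simpa using norm_integral_le_of_norm_le_const (μ := stepLaw μ n)
        (ae_of_all _ fun x ↦ f.norm_coe_le_norm x)
    refine (tendsto_inv_atTop_zero.comp (tendsto_natCast_atTop_atTop.comp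
      (tendsto_add_atTop_nat 1))).zero_mul_isBoundedUnder_le ?_
    exact isBoundedUnder_of ⟨‖f‖ + ‖f‖, fun N ↦ (norm_sub_le _ _).trans (add_le_add (hb _) (hb _))⟩
  have h1 := (hlim f).add (hsmall.mono_left Nat.hyperfilter_le_atTop)
  rw [add_zero] at h1
  exact h1.congr fun N ↦ (hdiff N).symm

/-! ### Uniqueness in the interior -/

section Uniqueness

variable {μ : Measure C(I, I)} [IsProbabilityMeasure μ]

/-- A stationary measure carried by `A` has a stationary piece `κ` whose typical orbits spend a
large proportion of their time in a fixed compact subset of `A`. -/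
lemma Stationary.exists_compact_piece {ν : Measure I} [IsFiniteMeasure ν] (hν : Stationary μ ν)
    (hν0 : ν ≠ 0) {A : Set I} (hA : MeasurableSet A) (hνA : ν Aᶜ = 0) {η : ℝ} (hη : 0 < η) :
    ∃ K ⊆ A, IsCompact K ∧ ∃ κ : Measure I, κ ≤ ν ∧ κ ≠ 0 ∧ Stationary μ κ ∧
      ∀ U, MeasurableSet U → κ U ≠ 0 → ∀ᶠ N : ℕ in atTop,
        (N : ℝ)⁻¹ * ∑ n ∈ Finset.range N, ⨍ x in U, escapeProb μ K n x ∂κ < η := by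
  have hpos : 0 < η * ν.real Set.univ := mul_pos hη
    (ENNReal.toReal_pos (by simpa using hν0) (measure_ne_top _ _))
  obtain ⟨K, hKA, hK, hdiff⟩ := hA.exists_isCompact_sdiff_lt (measure_ne_top ν A)
    (ENNReal.ofReal_pos.2 hpos).ne'
  have hKc : ν.real Kᶜ < η * ν.real Set.univ := by
    have h1 : ν Kᶜ ≤ ν (A \ K) := by
      calc ν Kᶜ ≤ ν (A \ K ∪ Aᶜ) := measure_mono fun x hx ↦ by
            by_cases hxA : x ∈ A
            · exact Or.inl ⟨hxA, hx⟩
            · exact Or.inr hxA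
        _ ≤ ν (A \ K) + ν Aᶜ := measure_union_le _ _
        _ = ν (A \ K) := by rw [hνA, add_zero]
    exact (ENNReal.lt_ofReal_iff_toReal_lt (measure_ne_top _ _)).1 (h1.trans_lt hdiff)
  obtain ⟨E, -, hE0, hEstat, hE⟩ := exists_restrict_cesaro_lt hν hK.measurableSet hKc
  exact ⟨K, hKA, hK, ν.restrict E, Measure.restrict_le_self,
    fun h ↦ hE0 (Measure.restrict_eq_zero.1 h), hEstat, hE⟩

/-- Uniqueness when every interior point can be moved towards the end `τ = 1`. -/
lemma eq_of_stationary (hBV : BV μ) {τ : I → I} (hτ : Continuous τ)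
    (hτI : ∀ x, τ x ∈ Set.Ioo (0 : I) 1 ↔ x ∈ Set.Ioo (0 : I) 1)
    (hU : ∀ x ∈ Set.Ioo (0 : I) 1, ∃ g ∈ μ.support, τ x < τ (g x))
    (hτV : ∀ (f : C(I, I)) (z : ℕ → I), Monotone (τ ∘ z) → ∀ n,
      ∑ k ∈ Finset.range n, edist (f (z (k + 1))) (f (z k)) ≤ variation f)
    {ν₁ ν₂ : Measure I} [IsProbabilityMeasure ν₁] [IsProbabilityMeasure ν₂]
    (h₁ : Stationary μ ν₁) (h₂ : Stationary μ ν₂)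
    (hI₁ : ν₁ (Set.Ioo 0 1)ᶜ = 0) (hI₂ : ν₂ (Set.Ioo 0 1)ᶜ = 0) : ν₁ = ν₂ := by
  by_contra hne
  have hsum : Stationary μ (ν₁ + ν₂) :=
    ⟨measurable_evalMap, by
      rw [Measure.prod_add, Measure.map_add _ _ measurable_evalMap, h₁.map_eq, h₂.map_eq]⟩
  have hI : (ν₁ + ν₂) (Set.Ioo 0 1)ᶜ = 0 := by simp [hI₁, hI₂]
  obtain ⟨A, hA, hA0, hAc0, hinv⟩ := exists_invariant_set h₁ hsum hne
  have hinv' : ∀ᵐ p ∂μ.prod (ν₁ + ν₂), p.1 p.2 ∈ Aᶜ ↔ p.2 ∈ Aᶜ := by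
    filter_upwards [hinv] with p hp
    exact not_congr hp
  obtain ⟨V, hV⟩ := hBV.exists_bound
  set η : ℝ := (Measure.infinitePi fun _ : ℕ ↦ μ).real
    {ω | ∀ n, variation (compSeq ω n) ≤ V} / 8 with hη
  have hηpos : 0 < η := div_pos (ENNReal.toReal_pos hV (measure_ne_top _ _)) (by norm_num)
  obtain ⟨K₁, hKA₁, hK₁, κ₁, hκ₁, hκ₁0, hκ₁s, hces₁⟩ :=
    (hsum.restrict hA hinv).exists_compact_piece (mt Measure.restrict_eq_zero.1 hA0) hA
      (by simp [Measure.restrict_apply hA.compl]) hηpos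
  obtain ⟨K₂, hKA₂, hK₂, κ₂, hκ₂, hκ₂0, hκ₂s, hces₂⟩ :=
    (hsum.restrict hA.compl hinv').exists_compact_piece (mt Measure.restrict_eq_zero.1 hAc0)
      hA.compl (by simp [Measure.restrict_apply hA]) hηpos
  have : IsFiniteMeasure κ₁ := isFiniteMeasure_of_le _ hκ₁
  have : IsFiniteMeasure κ₂ := isFiniteMeasure_of_le _ hκ₂
  have hκI₁ : κ₁ (Set.Ioo 0 1)ᶜ = 0 :=
    le_zero_iff.1 (((hκ₁.trans Measure.restrict_le_self) _).trans hI.le)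
  have hκI₂ : κ₂ (Set.Ioo 0 1)ᶜ = 0 :=
    le_zero_iff.1 (((hκ₂.trans Measure.restrict_le_self) _).trans hI.le)
  obtain ⟨δ, hδ, hsep⟩ := Metric.exists_pos_forall_lt_edist hK₁ hK₂.isClosed
    (disjoint_compl_right.mono hKA₁ hKA₂)
  have hsep' : ∀ x ∈ K₁, ∀ y ∈ K₂, (δ : ℝ) ≤ dist x y := fun x hx y hy ↦ by
    have h := hsep x hx y hy
    rw [edist_nndist] at h
    exact_mod_cast h.le
  let κ : ℕ → Measure I := fun k ↦ if Even k then κ₁ else κ₂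
  let K : ℕ → Set I := fun k ↦ if Even k then K₁ else K₂
  have hκfin : ∀ k, IsFiniteMeasure (κ k) := fun k ↦ by
    by_cases hk : Even k <;> simp only [κ, hk, if_true, if_false] <;> infer_instance
  refine not_alternating (μ := μ) (V := V) hηpos (by linarith) hτ.measurable hτV κ
    (fun k a ha ↦ ?_) K (fun k ↦ ?_) (NNReal.coe_pos.2 hδ) (fun k x hx y hy ↦ ?_) (fun k ↦ ?_)
  · by_cases hk : Even k
    · simpa only [κ, hk, if_true] using
        hκ₁s.exists_measure_Ioc_ne_zero hκ₁0 hκI₁ hτ hτI hU ha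
    · simpa only [κ, hk, if_false] using
        hκ₂s.exists_measure_Ioc_ne_zero hκ₂0 hκI₂ hτ hτI hU ha
  · by_cases hk : Even k
    · simpa only [K, hk, if_true] using hK₁.measurableSet
    · simpa only [K, hk, if_false] using hK₂.measurableSet
  · by_cases hk : Even k
    · have hk' : ¬ Even (k + 1) := by simpa [Nat.even_add_one] using hk
      simp only [K, hk, hk', if_true, if_false] at hx hy
      exact (hsep' x hx y hy).trans_eq (dist_comm _ _)
    · have hk' : Even (k + 1) := by simpa [Nat.even_add_one] using hk
      simp only [K, hk, hk', if_true, if_false] at hx hy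
      exact hsep' y hy x hx
  · by_cases hk : Even k
    · simpa only [κ, K, hk, if_true] using hces₁
    · simpa only [κ, K, hk, if_false] using hces₂

end Uniqueness

end StochSys

theorem corollary1p2 (μ : Measure C(I, I)) (hμ : IsProbabilityMeasure μ)
    (hBV : StochSys.BV μ) (hU : StochSys.U1 μ ∨ StochSys.U2 μ) :
    (∀ ν₁ ν₂ : Measure I,
      StochSys.IsInvariantProb μ ν₁ → ν₁ (Set.Ioo 0 1) = 1 →
      StochSys.IsInvariantProb μ ν₂ → ν₂ (Set.Ioo 0 1) = 1 → ν₁ = ν₂) ∧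
    ((∀ ν : Measure I, StochSys.IsInvariantProb μ ν → ν {0} = 0 ∧ ν {1} = 0) →
      StochSys.UniquelyErgodic μ) := by
  have huniq : ∀ ν₁ ν₂ : Measure I, StochSys.IsInvariantProb μ ν₁ → ν₁ (Set.Ioo 0 1) = 1 →
      StochSys.IsInvariantProb μ ν₂ → ν₂ (Set.Ioo 0 1) = 1 → ν₁ = ν₂ := by
    intro ν₁ ν₂ h₁ hI₁ h₂ hI₂
    have := h₁.isProbabilityMeasure
    have := h₂.isProbabilityMeasure
    have hc₁ := (prob_compl_eq_zero_iff measurableSet_Ioo).2 hI₁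
    have hc₂ := (prob_compl_eq_zero_iff measurableSet_Ioo).2 hI₂
    have hs₁ := StochSys.isInvariantProb_iff.1 h₁
    have hs₂ := StochSys.isInvariantProb_iff.1 h₂
    rcases hU with hU | hU
    · refine StochSys.eq_of_stationary hBV unitInterval.continuous_symm (fun x ↦ ?_)
        (fun x hx ↦ ?_) (fun f z hz n ↦ ?_) hs₁ hs₂ hc₁ hc₂
      · simp only [Set.mem_Ioo, unitInterval.pos_iff_ne_zero, unitInterval.lt_one_iff_ne_one,
          ne_eq, unitInterval.symm_eq_zero, unitInterval.symm_eq_one, and_comm]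
      · obtain ⟨g, hg, hgx⟩ := hU x hx
        exact ⟨g, hg, unitInterval.symm_lt_symm.2 hgx⟩
      · exact StochSys.sum_edist_le_variation_of_antitone f
          (fun i j hij ↦ unitInterval.symm_le_symm.1 (hz hij)) n
    · exact StochSys.eq_of_stationary hBV continuous_id (fun x ↦ Iff.rfl) hU
        (fun f z hz n ↦ StochSys.sum_edist_le_variation f hz n) hs₁ hs₂ hc₁ hc₂
  refine ⟨huniq, fun h ↦ ?_⟩
  have hmass : ∀ ν : Measure I, StochSys.IsInvariantProb μ ν → ν (Set.Ioo 0 1) = 1 := by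
    intro ν hν
    have := hν.isProbabilityMeasure
    refine (prob_compl_eq_zero_iff measurableSet_Ioo).1 ?_
    refine measure_mono_null (t := {0} ∪ {1}) (fun x hx ↦ ?_)
      (measure_union_null (h ν hν).1 (h ν hν).2)
    by_contra hx'
    simp only [Set.mem_union, Set.mem_singleton_iff, not_or] at hx'
    exact hx ⟨unitInterval.pos_iff_ne_zero.2 hx'.1, unitInterval.lt_one_iff_ne_one.2 hx'.2⟩
  obtain ⟨ν, hνp, hν⟩ := StochSys.exists_stationary μ
  have hνi := StochSys.isInvariantProb_iff.2 hν
  exact ⟨ν, hνi, fun ν' hν' ↦ huniq ν' ν hν' (hmass ν' hν') hνi (hmass ν hνi)⟩
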